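/- Conventions. A sequence of natural numbers $\kappa=(k_n)_{n\ge 0}$ is enumerated from $n=0$. For $p\in[1,\infty]$, $\kappa$ is called $L^p$-good universal if for every probability space $(X,\mathcal A,\mu)$, every measure preserving map $T:X\to X$ and every $g\in L^p(X,\mathcal A,\mu)$, the limit $\lim_{N\to\infty}\frac1N\sum_{n=0}^{N-1}g(T^{k_n}x)$ exists (in $\mathbb C$) for $\mu$-almost every $x$. $\kappa$ is called Hartman uniformly distributed if (a) for every integer $m>1$ and every residue class $r$ modulo $m$, $\lim_{N\to\infty}\frac1N\#\{0\le n<N:\ k_n\equiv r \bmod m\}=\frac1m$, and (b) for every irrational $a$, the sequence $(k_na)_{n\ge0}$ is uniformly distributed modulo one, i.e. $\lim_{N\to\infty}\frac1N\#\{0\le n<N:\ \{k_na\}\in I\}=|I|$ for every interval $I\subseteq[0,1)$, where $\{\cdot\}$ denotes the fractional part. For $\alpha>0$ and $\beta\in\mathbb R$ let $T_{\alpha,\beta}:\mathbb R\to\mathbb R$ be defined by $T_{\alpha,\beta}(x)=\frac{\alpha}{2}\left(\frac{x+\beta}{\alpha}-\frac{\alpha}{x-\beta}\right)$ for $x\ne\beta$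 and $T_{\alpha,\beta}(\beta)=\beta$; thus $T_{1,0}(x)=\frac12\left(x-\frac1x\right)$ for $x\neq 0$ is the Boole map. With $T=T_{\alpha,\beta}$ and $\zeta$ the Riemann zeta function put $$R_N(\sigma,x,\kappa)=\frac1N\sum_{n=0}^{N-1}\zeta\left(\sigma+iT^{k_n}x\right)\qquad(N=1,2,\dots).$$ Theorem 1.5. Let $\alpha>0$, $\beta\in\mathbb R$, $p\in[1,\infty]$ and $\sigma\in(1/2,1)$, and let $\kappa$ be Hartman uniformly distributed and $L^p$-good universal. Then $$\sum_{N\ge1}\left|R_{N+1}(\sigma,x,\kappa)-R_N(\sigma,x,\kappa)\right|=+\infty$$ for Lebesgue-almost every $x\in\mathbb R$. -/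

import Mathlib

open MeasureTheory Filter Topology
open scoped ENNReal

noncomputable section

/-- The average `(1/N) ∑_{n < N} u n` of the first `N` terms of a complex sequence. -/
def cesaroMean (u : ℕ → ℂ) (N : ℕ) : ℂ :=
  (1 / (N : ℂ)) * ∑ n ∈ Finset.range N, u n

/-- The map `T_{α,β}` of the real line. The case `α = 1`, `β = 0` is the Boole map
`x ↦ (x - 1/x) / 2` (with `0 ↦ 0`). -/
def booleMap (α β : ℝ) (x : ℝ) : ℝ :=
  if x = β then β else α / 2 * ((x + β) / α - α / (x - β))

/-- `κ` is `L^p`-good universal: for every measure preserving transformation `T` of a probability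
space `(X, μ)` and every `g ∈ L^p(μ)`, the averages of `g (T^{κ n} x)` converge for almost
every `x`. -/
def IsLpGoodUniversal (p : ℝ≥0∞) (κ : ℕ → ℕ) : Prop :=
  ∀ (X : Type) [MeasurableSpace X] (μ : Measure X) [IsProbabilityMeasure μ] (T : X → X),
    MeasurePreserving T μ μ → ∀ g : X → ℂ, MemLp g p μ →
      ∀ᵐ x ∂μ, ∃ l : ℂ, Tendsto (fun N : ℕ => cesaroMean (fun n => g (T^[κ n] x)) N) atTop (𝓝 l)

open Classical in
/-- The proportion of those indices `n < N` which satisfy `P`. -/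
def proportion (P : ℕ → Prop) (N : ℕ) : ℝ :=
  (((Finset.range N).filter P).card : ℝ) / (N : ℝ)

/-- Uniform distribution modulo one of a real sequence: for every interval `I ⊆ [0, 1)`,
the proportion of fractional parts in `I` tends to the length of `I`. -/
def IsUniformlyDistributedModOne (x : ℕ → ℝ) : Prop :=
  ∀ I : Set ℝ, I.OrdConnected → I ⊆ Set.Ico 0 1 →
    Tendsto (proportion (fun n => Int.fract (x n) ∈ I)) atTop (𝓝 (volume.real I))

/-- Uniform distribution on `ℤ`: equidistribution among the residue classes modulo every
`m > 1`. -/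
def IsUniformlyDistributedInt (k : ℕ → ℤ) : Prop :=
  ∀ m : ℕ, 1 < m → ∀ r : ℤ,
    Tendsto (proportion (fun n => k n ≡ r [ZMOD (m : ℤ)])) atTop (𝓝 (1 / (m : ℝ)))

/-- Hartman uniform distribution of a sequence of natural numbers. -/
def IsHartmanUniformlyDistributed (κ : ℕ → ℕ) : Prop :=
  IsUniformlyDistributedInt (fun n => (κ n : ℤ)) ∧
    ∀ a : ℝ, Irrational a → IsUniformlyDistributedModOne (fun n => (κ n : ℝ) * a)

/-- `R_N(s, x, κ) = (1/N) ∑_{n < N} ζ(s + i T^{κ n} x)` for a map `T` of the real line. -/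
def zetaAverage (T : ℝ → ℝ) (κ : ℕ → ℕ) (s : ℂ) (x : ℝ) (N : ℕ) : ℂ :=
  cesaroMean (fun n => riemannZeta (s + Complex.I * ((T^[κ n] x : ℝ) : ℂ))) N

end

noncomputable section

/-! An arctangent angle turns `booleMap α β` into doubling on the circle `ℝ ⧸ πℤ`. There the Weyl
sums along `κ` converge a.e. by good universality, and their squared `L²` norm is the density of
coincidences `κ i = κ j`, which vanishes; so the limit is 0 and almost every orbit equidistributes
along `κ` (`ae_tendsto_cesaroMean_booleMap`). Only equidistribution modulo integers is needed.
Finite variation would force the averages to some limit `L`. Since `R_{N+1} - R_N = (u_N - R_N) / (N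
+ 1)` and zeta is not identically `L` on the line, the orbit meets an open set where `|ζ - L| > δ`
with positive density, and the variation dominates a divergent logarithmic sum
(`tsum_enorm_cesaroMean_sub_eq_top`). -/

/-- Coincidences `κ i = κ j` have density zero when `κ` is equidistributed modulo every integer. -/
theorem IsUniformlyDistributedInt.tendsto_coincidences {κ : ℕ → ℕ}
    (h : IsUniformlyDistributedInt (fun n => (κ n : ℤ))) :
    Tendsto (fun N : ℕ => ((N : ℝ)⁻¹) ^ 2 *
      ∑ i ∈ Finset.range N, ∑ j ∈ Finset.range N, (if κ i = κ j then (1 : ℝ) else 0))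
      atTop (𝓝 0) := by
  classical
  rw [Metric.tendsto_atTop']
  intro ε hε
  obtain ⟨m, hm⟩ := exists_nat_gt (max 1 (2 / ε))
  have hm1 : 1 < m := by exact_mod_cast (le_max_left _ _).trans_lt hm
  have hm0 : (0 : ℝ) < m := by positivity
  have hmε : 2 / (m : ℝ) < ε := by
    rw [div_lt_comm₀ hm0 hε]; exact (le_max_right _ _).trans_lt hm
  have hev : ∀ᶠ N : ℕ in atTop, ∀ r ∈ Finset.range m,
      proportion (fun n => (κ n : ℤ) ≡ (r : ℤ) [ZMOD (m : ℤ)]) N < 2 / (m : ℝ) := by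
    rw [Filter.eventually_all_finset]
    intro r _
    refine (h m hm1 r).eventually_lt_const ?_
    gcongr; norm_num
  obtain ⟨N₀, hN₀⟩ := eventually_atTop.1 hev
  refine ⟨N₀, fun N hN => ?_⟩
  have hNpos : (0 : ℝ) < N := by
    have : 0 < N := by omega
    exact_mod_cast this
  -- Equality `κ i = κ j` puts `κ j` in the class of `κ i` modulo `m`, of proportion below `2 / m`.
  have hrow : ∀ i, ∑ j ∈ Finset.range N, (if κ i = κ j then (1 : ℝ) else 0) ≤ 2 / m * N := by
    intro i
    have h1 := hN₀ N hN.le (κ i % m) (Finset.mem_range.2 (Nat.mod_lt _ (by omega)))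
    rw [proportion, div_lt_iff₀ hNpos] at h1
    refine le_trans ?_ h1.le
    rw [Finset.sum_ite, Finset.sum_const_zero, add_zero, Finset.sum_const, nsmul_eq_mul, mul_one]
    refine Nat.cast_le.2 ?_
    refine Finset.card_le_card fun j hj => ?_
    simp only [Finset.mem_filter] at hj ⊢
    refine ⟨hj.1, ?_⟩
    refine Int.natCast_modEq_iff.2 ?_
    rw [← hj.2]
    exact (Nat.mod_modEq _ _).symm
  have hnn : 0 ≤ ∑ i ∈ Finset.range N, ∑ j ∈ Finset.range N,
      (if κ i = κ j then (1 : ℝ) else 0) :=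
    Finset.sum_nonneg fun i _ => Finset.sum_nonneg fun j _ => by split_ifs <;> norm_num
  rw [Real.dist_0_eq_abs, abs_of_nonneg (by positivity)]
  calc _ ≤ ((N : ℝ)⁻¹) ^ 2 * ∑ _i ∈ Finset.range N, (2 / m * N : ℝ) := by
        gcongr with i _; exact hrow i
    _ = 2 / m := by rw [Finset.sum_const, Finset.card_range, nsmul_eq_mul]; field_simp
    _ < ε := hmε

/-! ### Weyl sums for the doubling map -/

namespace AddCircle

variable {T : ℝ}

/-- The Weyl sums of the frequency `n` along `2 ^ κ i`. -/
def weylMean (κ : ℕ → ℕ) (n : ℤ) (N : ℕ) : C(AddCircle T, ℂ) :=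
  (1 / (N : ℂ)) • ∑ i ∈ Finset.range N, fourier (n * 2 ^ κ i)

theorem iterate_two_nsmul (k : ℕ) (t : AddCircle T) :
    (fun y : AddCircle T => (2 : ℕ) • y)^[k] t = (2 ^ k : ℕ) • t := by
  induction k with
  | zero => simp
  | succ k ih => rw [Function.iterate_succ_apply', ih, smul_smul, pow_succ']

theorem weylMean_apply (κ : ℕ → ℕ) (n : ℤ) (N : ℕ) (t : AddCircle T) :
    weylMean κ n N t = cesaroMean (fun i => fourier n ((2 ^ κ i : ℕ) • t)) N := by
  have h : ∀ k : ℕ, fourier (n * 2 ^ k) t = fourier n ((2 ^ k : ℕ) • t) := fun k => by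
    rw [fourier_apply, fourier_apply, ← natCast_zsmul, smul_smul]; push_cast; rfl
  simp [weylMean, cesaroMean, ← h, -fourier_apply]

variable [hT : Fact (0 < T)]

/-- By orthonormality of characters, the squared norm counts pairs with `n * 2 ^ κ i = n * 2 ^ κ j`,
that is `κ i = κ j`. -/
theorem tendsto_toLp_weylMean {κ : ℕ → ℕ}
    (h : IsUniformlyDistributedInt (fun n => (κ n : ℤ))) {n : ℤ} (hn : n ≠ 0) :
    Tendsto (fun N => ContinuousMap.toLp (E := ℂ) 2 (@haarAddCircle T hT) ℂ (weylMean κ n N))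
      atTop (𝓝 0) := by
  have hinj : ∀ i j, n * 2 ^ κ i = n * 2 ^ κ j ↔ κ i = κ j := fun i j => by
    constructor
    · intro e
      have := mul_left_cancel₀ hn e
      exact Nat.pow_right_injective le_rfl (by exact_mod_cast this)
    · intro e; rw [e]
  have key : ∀ N, ‖ContinuousMap.toLp (E := ℂ) 2 (@haarAddCircle T hT) ℂ (weylMean κ n N)‖ ^ 2 =
      ((N : ℝ)⁻¹) ^ 2 *
      ∑ i ∈ Finset.range N, ∑ j ∈ Finset.range N, (if κ i = κ j then (1 : ℝ) else 0) := by
    intro N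
    have e : ContinuousMap.toLp (E := ℂ) 2 (@haarAddCircle T hT) ℂ (weylMean κ n N) =
        (1 / (N : ℂ)) • ∑ i ∈ Finset.range N, fourierLp 2 (n * 2 ^ κ i) := by
      rw [weylMean, map_smul, map_sum]
    rw [e, norm_smul, mul_pow]
    congr 1
    · simp
    · rw [← inner_self_eq_norm_sq (𝕜 := ℂ), sum_inner, map_sum]
      refine Finset.sum_congr rfl fun i _ => ?_
      rw [inner_sum, map_sum]
      refine Finset.sum_congr rfl fun j _ => ?_
      rw [orthonormal_iff_ite.1 orthonormal_fourier, apply_ite RCLike.re]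
      simp [hinj]
  rw [tendsto_zero_iff_norm_tendsto_zero]
  have := h.tendsto_coincidences
  simp_rw [← key] at this
  simpa using this.sqrt

theorem measurePreserving_two_nsmul :
    MeasurePreserving (fun y : AddCircle T => (2 : ℕ) • y) haarAddCircle haarAddCircle := by
  have h := (ergodic_nsmul (T := T) one_lt_two).toMeasurePreserving
  refine ⟨h.measurable, ?_⟩
  have h2 := h.map_eq
  have hc : ENNReal.ofReal T ≠ 0 := by simpa using hT.out
  rw [volume_eq_smul_haarAddCircle, Measure.map_smul] at h2
  have := congrArg (fun μ => (ENNReal.ofReal T)⁻¹ • μ) h2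
  simpa [smul_smul, ENNReal.inv_mul_cancel hc] using this

/-- Good universality supplies an a.e. limit; an a.e. convergent subsequence of the `L²`-null means
identifies it as 0. -/
theorem ae_tendsto_weylMean {κ : ℕ → ℕ} {p : ℝ≥0∞}
    (h : IsUniformlyDistributedInt (fun n => (κ n : ℤ))) (hgood : IsLpGoodUniversal p κ)
    {n : ℤ} (hn : n ≠ 0) :
    ∀ᵐ t ∂(@haarAddCircle T hT), Tendsto (fun N => weylMean κ n N t) atTop (𝓝 0) := by
  have hlim := hgood (AddCircle T) haarAddCircle _ measurePreserving_two_nsmul (fourier n)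
    (MemLp.of_bound (map_continuous _).aestronglyMeasurable 1
      (ae_of_all _ fun t => by rw [fourier_apply, Circle.norm_coe]))
  simp only [iterate_two_nsmul, ← weylMean_apply] at hlim
  obtain ⟨ns, hns, hae⟩ := (tendstoInMeasure_of_tendsto_Lp
    (tendsto_toLp_weylMean (T := T) h hn)).exists_seq_tendsto_ae
  have hco : ∀ᵐ t ∂(@haarAddCircle T hT), ∀ N,
      ContinuousMap.toLp (E := ℂ) 2 (@haarAddCircle T hT) ℂ (weylMean κ n N) t = weylMean κ n N t :=
    ae_all_iff.2 fun N => ContinuousMap.coeFn_toLp _ _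
  filter_upwards [hlim, hae, hco, Lp.coeFn_zero ℂ 2 (@haarAddCircle T hT)] with t ⟨l, hl⟩ h1 h2 h3
  simp only [h2, h3, Pi.zero_apply] at h1
  rwa [tendsto_nhds_unique (hl.comp hns.tendsto_atTop) h1] at hl

end AddCircle

/-! ### Weyl's criterion and equidistribution -/

theorem cesaroMean_add (u v : ℕ → ℂ) (N : ℕ) :
    cesaroMean (fun n => u n + v n) N = cesaroMean u N + cesaroMean v N := by
  simp [cesaroMean, Finset.sum_add_distrib, mul_add]

theorem cesaroMean_const_mul (c : ℂ) (u : ℕ → ℂ) (N : ℕ) :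
    cesaroMean (fun n => c * u n) N = c * cesaroMean u N := by
  simp only [cesaroMean, ← Finset.mul_sum]; ring

theorem norm_cesaroMean_sub_le {u v : ℕ → ℂ} {ε : ℝ} (hε : 0 ≤ ε) (h : ∀ n, ‖u n - v n‖ ≤ ε)
    (N : ℕ) : ‖cesaroMean u N - cesaroMean v N‖ ≤ ε := by
  rw [cesaroMean, cesaroMean, ← mul_sub, ← Finset.sum_sub_distrib, norm_mul]
  have h1 := norm_sum_le_of_le (Finset.range N) fun n _ => h n
  rw [Finset.sum_const, Finset.card_range, nsmul_eq_mul] at h1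
  have h2 : ‖(1 / (N : ℂ))‖ = (N : ℝ)⁻¹ := by simp
  rw [h2]
  calc _ ≤ (N : ℝ)⁻¹ * (N * ε) := by gcongr
    _ = ((N : ℝ)⁻¹ * N) * ε := by ring
    _ ≤ 1 * ε := by gcongr; exact inv_mul_le_one
    _ = ε := one_mul ε

namespace AddCircle

variable {T : ℝ} [hT : Fact (0 < T)]

/-- Weyl's criterion on the circle. -/
theorem tendsto_cesaroMean_of_fourier {x : ℕ → AddCircle T}
    (hx : ∀ n : ℤ, n ≠ 0 → Tendsto (cesaroMean fun i => fourier n (x i)) atTop (𝓝 0))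
    (f : C(AddCircle T, ℂ)) :
    Tendsto (cesaroMean fun i => f (x i)) atTop (𝓝 (∫ t, f t ∂haarAddCircle)) := by
  have hint : ∀ g : C(AddCircle T, ℂ), Integrable g (@haarAddCircle T hT) := fun g =>
    g.continuous.integrable_of_hasCompactSupport (HasCompactSupport.of_compactSpace _)
  have hspan : ∀ g ∈ Submodule.span ℂ (Set.range (@fourier T)),
      Tendsto (cesaroMean fun i => g (x i)) atTop (𝓝 (∫ t, g t ∂haarAddCircle)) := by
    intro g hg
    induction hg using Submodule.span_induction with
    | mem g hg =>
      obtain ⟨n, rfl⟩ := hg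
      by_cases hn : n = 0
      · subst hn
        refine tendsto_const_nhds.congr' ?_
        filter_upwards [eventually_gt_atTop 0] with N hN
        have : (N : ℂ) ≠ 0 := by exact_mod_cast hN.ne'
        simp [cesaroMean, this]
      · have := integral_eq_zero_of_add_right_eq_neg (μ := @haarAddCircle T hT)
          (fourier_add_half_inv_index hn hT.elim)
        rw [this]
        exact hx n hn
    | zero =>
      have h0 : (cesaroMean fun _ => (0 : ℂ)) = fun _ => 0 := funext fun N => by simp [cesaroMean]
      simp [h0]
    | add g k _ _ hg hk =>
      simp only [ContinuousMap.add_apply]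
      rw [integral_add (hint g) (hint k)]
      exact (hg.add hk).congr fun N => (cesaroMean_add _ _ N).symm
    | smul c g _ hg =>
      simp only [ContinuousMap.smul_apply, smul_eq_mul]
      rw [integral_const_mul]
      exact (hg.const_mul c).congr fun N => (cesaroMean_const_mul _ _ N).symm
  have hf : f ∈ closure (Submodule.span ℂ (Set.range (@fourier T)) : Set C(AddCircle T, ℂ)) := by
    rw [← Submodule.topologicalClosure_coe, span_fourier_closure_eq_top]; trivial
  rw [Metric.tendsto_atTop']
  intro ε hε
  obtain ⟨g, hg, hfg⟩ := Metric.mem_closure_iff.1 hf (ε / 3) (by positivity)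
  have hfg' : ∀ t, ‖f t - g t‖ ≤ ε / 3 := fun t => by
    rw [← dist_eq_norm]; exact (ContinuousMap.dist_apply_le_dist t).trans hfg.le
  obtain ⟨N₀, hN₀⟩ := Metric.tendsto_atTop'.1 (hspan g hg) (ε / 3) (by positivity)
  refine ⟨N₀, fun N hN => ?_⟩
  have h1 := norm_cesaroMean_sub_le (by positivity) (fun n => hfg' (x n)) N
  have h2 := hN₀ N hN
  have h3 : ‖∫ t, f t ∂(@haarAddCircle T hT) - ∫ t, g t ∂(@haarAddCircle T hT)‖ ≤ ε / 3 := by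
    rw [← integral_sub (hint f) (hint g)]
    simpa using norm_integral_le_of_norm_le_const (μ := @haarAddCircle T hT) (ae_of_all _ hfg')
  rw [← dist_eq_norm] at h1 h3
  rw [dist_comm] at h3
  linarith [dist_triangle4 (cesaroMean (fun i => f (x i)) N) (cesaroMean (fun i => g (x i)) N)
    (∫ t, g t ∂(@haarAddCircle T hT)) (∫ t, f t ∂(@haarAddCircle T hT))]

/-- There are countably many frequencies, so one null set serves all `f`. -/
theorem ae_tendsto_cesaroMean_two_pow {κ : ℕ → ℕ} {p : ℝ≥0∞}
    (h : IsUniformlyDistributedInt (fun n => (κ n : ℤ))) (hgood : IsLpGoodUniversal p κ) :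
    ∀ᵐ t ∂(@haarAddCircle T hT), ∀ f : C(AddCircle T, ℂ),
      Tendsto (cesaroMean fun i => f ((2 ^ κ i : ℕ) • t)) atTop
        (𝓝 (∫ s, f s ∂haarAddCircle)) := by
  have : ∀ᵐ t ∂(@haarAddCircle T hT), ∀ n : ℤ, n ≠ 0 →
      Tendsto (fun N => weylMean κ n N t) atTop (𝓝 0) := by
    rw [ae_all_iff]
    intro n
    by_cases hn : n = 0
    · simp [hn]
    · filter_upwards [ae_tendsto_weylMean h hgood hn] with t ht _ using ht
  filter_upwards [this] with t ht f
  refine tendsto_cesaroMean_of_fourier (fun n hn => ?_) f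
  exact (ht n hn).congr fun N => weylMean_apply κ n N t

end AddCircle

/-! ### Conjugacy with angle doubling -/

/-- The lift to `ℝ` of the angle coordinate that linearizes `booleMap α β`. -/
def booleAngle (α β x : ℝ) : ℝ := Real.arctan ((x - β) / α) + Real.pi / 2

instance fact_pi_pos : Fact (0 < Real.pi) := ⟨Real.pi_pos⟩

/-- The conjugacy from the real line to the circle `ℝ ⧸ πℤ`. -/
def booleCircle (α β x : ℝ) : AddCircle Real.pi := (booleAngle α β x : AddCircle Real.pi)

theorem booleAngle_mem_Ioo (α β x : ℝ) : booleAngle α β x ∈ Set.Ioo 0 Real.pi := by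
  have h := Real.arctan_mem_Ioo ((x - β) / α)
  constructor <;> simp only [booleAngle] <;> linarith [h.1, h.2]

theorem booleAngle_leftInverse {α : ℝ} (hα : α ≠ 0) (β x : ℝ) :
    β + α * Real.tan (booleAngle α β x - Real.pi / 2) = x := by
  rw [booleAngle, add_sub_cancel_right, Real.tan_arctan]; field_simp; ring

theorem booleCircle_injective {α : ℝ} (hα : α ≠ 0) (β : ℝ) :
    Function.Injective (booleCircle α β) := by
  intro x y h
  have hm : ∀ z, booleAngle α β z ∈ Set.Ico 0 (0 + Real.pi) := fun z => by
    rw [zero_add]; exact Set.Ioo_subset_Ico_self (booleAngle_mem_Ioo α β z)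
  have := (AddCircle.coe_eq_coe_iff_of_mem_Ico (hm x) (hm y)).1 h
  rw [← booleAngle_leftInverse hα β x, this, booleAngle_leftInverse hα]

theorem isOpenMap_booleAngle {α : ℝ} (hα : α ≠ 0) (β : ℝ) : IsOpenMap (booleAngle α β) := by
  refine isOpenMap_of_hasStrictDerivAt (f' := fun x => 1 / (1 + ((x - β) / α) ^ 2) * (1 / α))
    (fun x => ?_) fun x => ?_
  · have h : HasStrictDerivAt (fun y => (y - β) / α) (1 / α) x :=
      HasStrictDerivAt.div_const ((hasStrictDerivAt_id x).sub_const β) α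
    exact h.arctan.add_const _
  · have : 0 < 1 + ((x - β) / α) ^ 2 := by positivity
    exact mul_ne_zero (one_div_ne_zero this.ne') (one_div_ne_zero hα)

theorem isOpenMap_booleCircle {α : ℝ} (hα : α ≠ 0) (β : ℝ) : IsOpenMap (booleCircle α β) :=
  QuotientAddGroup.isOpenMap_coe.comp (isOpenMap_booleAngle hα β)

theorem tan_two_mul_arctan_sub (y : ℝ) :
    Real.tan (2 * Real.arctan y - Real.pi / 2) = (y - 1 / y) / 2 := by
  rw [← neg_sub, Real.tan_neg, Real.tan_pi_div_two_sub, Real.tan_two_mul, Real.tan_arctan]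
  by_cases hy : y = 0
  · simp [hy]
  · rw [inv_div]; field_simp; ring

/-- `booleMap α β` is conjugate to the doubling map. -/
theorem booleCircle_booleMap {α : ℝ} (hα : α ≠ 0) {β x : ℝ} (hx : x ≠ β) :
    booleCircle α β (booleMap α β x) = 2 • booleCircle α β x := by
  set y := (x - β) / α with hy
  have hy0 : y ≠ 0 := div_ne_zero (sub_ne_zero.2 hx) hα
  have hxβ : x - β ≠ 0 := sub_ne_zero.2 hx
  have hT : (booleMap α β x - β) / α = (y - 1 / y) / 2 := by
    rw [booleMap, if_neg hx, hy]; field_simp; ring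
  have ha := Real.arctan_mem_Ioo y
  rw [booleCircle, booleCircle, booleAngle, booleAngle, hT, ← hy, ← QuotientAddGroup.mk_nsmul,
    nsmul_eq_mul]
  -- The sign of `y` decides which translate of `2 * arctan y - π / 2` by a multiple of `π` lies in
  -- the range of `arctan`.
  rcases hy0.lt_or_gt with h | h
  · have h0 : Real.arctan y < 0 := by simpa using h
    rw [Real.arctan_eq_of_tan_eq (x := 2 * Real.arctan y - Real.pi / 2 + Real.pi)
      (by rw [Real.tan_periodic, tan_two_mul_arctan_sub])
      ⟨by linarith [ha.1], by linarith⟩]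
    congr 1; push_cast; ring
  · have h0 : 0 < Real.arctan y := by simpa using h
    rw [Real.arctan_eq_of_tan_eq (x := 2 * Real.arctan y - Real.pi / 2)
      (tan_two_mul_arctan_sub y) ⟨by linarith, by linarith [ha.2]⟩]
    rw [← AddCircle.coe_add_period]
    congr 1; push_cast; ring

theorem booleCircle_self (α β : ℝ) : 2 • booleCircle α β β = 0 := by
  rw [booleCircle, booleAngle, ← QuotientAddGroup.mk_nsmul, nsmul_eq_mul]
  have : ((2 : ℕ) : ℝ) * (Real.arctan ((β - β) / α) + Real.pi / 2) = Real.pi := by simp; ring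
  rw [this]; exact AddCircle.coe_period _

/-- The exceptional point `β` has angle `π / 2`, which doubles to 0; an orbit avoiding 0 on the
circle therefore never meets `β`. -/
theorem booleCircle_iterate {α : ℝ} (hα : α ≠ 0) {β x : ℝ}
    (hx : ∀ k : ℕ, (2 ^ k : ℕ) • booleCircle α β x ≠ 0) (k : ℕ) :
    booleCircle α β ((booleMap α β)^[k] x) = (2 ^ k : ℕ) • booleCircle α β x := by
  induction k with
  | zero => simp
  | succ k ih =>
    rw [Function.iterate_succ_apply', booleCircle_booleMap hα, ih, smul_smul, pow_succ']
    intro h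
    apply hx (k + 1)
    rw [pow_succ', ← smul_smul, ← ih, h, booleCircle_self]

theorem measurable_booleCircle (α β : ℝ) : Measurable (booleCircle α β) := by
  refine AddCircle.measurable_mk'.comp ?_
  unfold booleAngle
  fun_prop

/-- The inverse, a shifted tangent, is differentiable and so carries null sets to null sets. -/
theorem quasiMeasurePreserving_booleCircle {α : ℝ} (hα : α ≠ 0) (β : ℝ) :
    Measure.QuasiMeasurePreserving (booleCircle α β) volume AddCircle.haarAddCircle := by
  refine ⟨measurable_booleCircle α β, Measure.AbsolutelyContinuous.mk fun s hs h0 => ?_⟩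
  rw [Measure.map_apply (measurable_booleCircle α β) hs]
  have hv : (volume : Measure (AddCircle Real.pi)) s = 0 := by
    rw [AddCircle.volume_eq_smul_haarAddCircle, Measure.smul_apply, h0, smul_zero]
  have h1 := (AddCircle.measurePreserving_mk Real.pi 0).measure_preimage hs.nullMeasurableSet
  rw [hv, Measure.restrict_apply (AddCircle.measurable_mk' hs), zero_add] at h1
  set S := ((↑) : ℝ → AddCircle Real.pi) ⁻¹' s ∩ Set.Ioo 0 Real.pi
  have hS : volume S = 0 :=
    measure_mono_null (Set.inter_subset_inter_right _ Set.Ioo_subset_Ioc_self) h1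
  have hd : DifferentiableOn ℝ (fun t => β + α * Real.tan (t - Real.pi / 2)) S := by
    intro t ht
    have hc : Real.cos (t - Real.pi / 2) ≠ 0 :=
      (Real.cos_pos_of_mem_Ioo ⟨by linarith [ht.2.1], by linarith [ht.2.2]⟩).ne'
    have := (Real.differentiableAt_tan.2 hc).comp t (differentiableAt_id.sub_const (Real.pi / 2))
    exact ((this.const_mul α).const_add β).differentiableWithinAt
  refine measure_mono_null ?_
    (addHaar_image_eq_zero_of_differentiableOn_of_addHaar_eq_zero volume hd hS)
  intro x hx
  exact ⟨booleAngle α β x, ⟨hx, booleAngle_mem_Ioo α β x⟩, booleAngle_leftInverse hα β x⟩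

theorem ae_two_pow_nsmul_booleCircle_ne_zero {α : ℝ} (hα : α ≠ 0) (β : ℝ) :
    ∀ᵐ x : ℝ, ∀ k : ℕ, (2 ^ k : ℕ) • booleCircle α β x ≠ 0 := by
  rw [ae_all_iff]
  intro k
  have hfin : {t : AddCircle Real.pi | (2 ^ k : ℕ) • t = 0}.Finite := by
    refine Set.Finite.subset (AddCircle.finite_torsion Real.pi (n := 2 ^ k) (by positivity)) ?_
    exact fun t ht => ht
  have := (hfin.preimage (booleCircle_injective hα β).injOn).measure_zero volume
  rw [ae_iff]
  simpa using this

/-- Along almost every orbit of `booleMap α β`, the averages of continuous functions of the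
circle coordinate converge to the space mean. -/
theorem ae_tendsto_cesaroMean_booleMap {α : ℝ} (hα : α ≠ 0) (β : ℝ) {κ : ℕ → ℕ} {p : ℝ≥0∞}
    (h : IsUniformlyDistributedInt (fun n => (κ n : ℤ))) (hgood : IsLpGoodUniversal p κ) :
    ∀ᵐ x : ℝ, ∀ f : C(AddCircle Real.pi, ℂ),
      Tendsto (cesaroMean fun i => f (booleCircle α β ((booleMap α β)^[κ i] x))) atTop
        (𝓝 (∫ s, f s ∂AddCircle.haarAddCircle)) := by
  filter_upwards [ae_two_pow_nsmul_booleCircle_ne_zero hα β,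
    (quasiMeasurePreserving_booleCircle hα β).ae
      (AddCircle.ae_tendsto_cesaroMean_two_pow h hgood)] with x hx hx' f
  simpa only [booleCircle_iterate hα hx] using hx' f

/-! ### Infinite variation of averages -/

/-- Nonnegative terms with a positive mean value have a divergent logarithmic sum. -/
theorem not_summable_div_of_tendsto_average {w : ℕ → ℝ} (hw : ∀ n, 0 ≤ w n) {m : ℝ} (hm : 0 < m)
    (h : Tendsto (fun N : ℕ => (∑ n ∈ Finset.range N, w n) / N) atTop (𝓝 m)) :
    ¬ Summable fun n : ℕ => w n / (n + 1) := by
  intro hs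
  have hdouble : Tendsto (fun N : ℕ => 2 * N) atTop atTop :=
    tendsto_id.const_mul_atTop' (by norm_num)
  have h1 := hs.hasSum.tendsto_sum_nat
  -- Block sums over `[N, 2N)` tend to 0 if the series converges, yet they dominate a quantity
  -- tending to `m - m / 2`.
  have h2 := (h1.comp hdouble).sub h1
  have h3 := (h.comp hdouble).sub (h.div_const 2)
  refine absurd (le_of_tendsto_of_tendsto h3 h2 ?_) (by linarith)
  filter_upwards [eventually_gt_atTop 0] with N hN
  have hN0 : (0 : ℝ) < N := by exact_mod_cast hN
  simp only [Function.comp_apply]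
  rw [← Finset.sum_Ico_eq_sub _ (by omega : N ≤ 2 * N)]
  have e : (∑ n ∈ Finset.range (2 * N), w n) / ((2 * N : ℕ) : ℝ)
      - (∑ n ∈ Finset.range N, w n) / N / 2 = ∑ n ∈ Finset.Ico N (2 * N), w n / (2 * N) := by
    rw [← Finset.sum_div, Finset.sum_Ico_eq_sub _ (by omega : N ≤ 2 * N)]
    push_cast; field_simp
  rw [e]
  refine Finset.sum_le_sum fun n hn => ?_
  have hn2 : ((n + 1 : ℕ) : ℝ) ≤ ((2 * N : ℕ) : ℝ) := by
    exact_mod_cast (Finset.mem_Ico.1 hn).2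
  push_cast at hn2
  exact div_le_div_of_nonneg_left (hw n) (by positivity) hn2

theorem cesaroMean_succ_sub (u : ℕ → ℂ) {N : ℕ} (hN : N ≠ 0) :
    cesaroMean u (N + 1) - cesaroMean u N = (u N - cesaroMean u N) / ((N : ℂ) + 1) := by
  have h0 : (N : ℂ) ≠ 0 := by exact_mod_cast hN
  have h1 : (N : ℂ) + 1 ≠ 0 := by exact_mod_cast N.succ_ne_zero
  simp only [cesaroMean, Finset.sum_range_succ, Nat.cast_add, Nat.cast_one]
  field_simp
  ring

/-- If a sequence stays away from every given number on a set of indices that has a positive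
weighted density, then its averages have infinite variation. -/
theorem tsum_enorm_cesaroMean_sub_eq_top {u : ℕ → ℂ}
    (hu : ∀ L : ℂ, ∃ (w : ℕ → ℝ) (M δ m : ℝ), 0 < δ ∧ 0 < m ∧ (∀ n, 0 ≤ w n) ∧ (∀ n, w n ≤ M) ∧
      (∀ n, w n ≠ 0 → δ ≤ ‖u n - L‖) ∧
      Tendsto (fun N : ℕ => (∑ n ∈ Finset.range N, w n) / N) atTop (𝓝 m)) :
    ∑' N : ℕ, ‖cesaroMean u (N + 2) - cesaroMean u (N + 1)‖ₑ = ∞ := by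
  by_contra hfin
  have hs : Summable fun N : ℕ => ‖cesaroMean u (N + 2) - cesaroMean u (N + 1)‖ := by
    have := ENNReal.summable_toReal hfin
    simpa only [toReal_enorm] using this
  obtain ⟨L, hL⟩ := cauchySeq_tendsto_of_complete
    (cauchySeq_of_summable_dist (f := fun N => cesaroMean u (N + 1))
      (hs.congr fun N => by rw [dist_comm, dist_eq_norm]))
  obtain ⟨w, M, δ, m, hδ, hm, hw0, hwM, hwδ, hwm⟩ := hu L
  refine not_summable_div_of_tendsto_average hw0 hm hwm ?_
  have hM : 0 ≤ M := (hw0 0).trans (hwM 0)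
  rw [← summable_nat_add_iff 1]
  refine Summable.of_norm_bounded_eventually_nat (hs.mul_left (M * (2 / δ))) ?_
  filter_upwards [Metric.tendsto_nhds.1 hL (δ / 2) (by positivity)] with N hN
  rw [dist_eq_norm] at hN
  rw [cesaroMean_succ_sub u (N := N + 1) N.succ_ne_zero, norm_div, norm_div]
  have hpos : (0 : ℝ) < ((N + 1 : ℕ) : ℝ) + 1 := by positivity
  have hden : ‖((N + 1 : ℕ) : ℂ) + 1‖ = ((N + 1 : ℕ) : ℝ) + 1 := by
    exact_mod_cast Complex.norm_natCast (N + 1 + 1)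
  rw [hden, Real.norm_of_nonneg (hw0 _), Real.norm_of_nonneg hpos.le, mul_div_assoc']
  refine div_le_div_of_nonneg_right ?_ hpos.le
  by_cases h0 : w (N + 1) = 0
  · rw [h0]; positivity
  · have h1 : δ / 2 ≤ ‖u (N + 1) - cesaroMean u (N + 1)‖ := by
      have h2 := hwδ _ h0
      have h3 := norm_sub_le_norm_sub_add_norm_sub (u (N + 1)) (cesaroMean u (N + 1)) L
      linarith
    calc w (N + 1) ≤ M * (2 / δ) * (δ / 2) := by
          rw [mul_assoc, div_mul_div_cancel₀ hδ.ne', div_self two_ne_zero, mul_one]; exact hwM _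
      _ ≤ _ := by gcongr

/-! ### Zeta on vertical lines, and weights -/

/-- The zeta function is not constant on a vertical line. -/
theorem exists_riemannZeta_ne {σ : ℝ} (hσ : σ ≠ 1) (L : ℂ) :
    ∃ t : ℝ, riemannZeta (σ + Complex.I * t) ≠ L := by
  by_contra! h
  have hU : IsPreconnected ({1}ᶜ : Set ℂ) :=
    (isConnected_compl_singleton_of_one_lt_rank (by simp) 1).isPreconnected
  have hd : DifferentiableOn ℂ riemannZeta {1}ᶜ := fun s hs =>
    (differentiableAt_riemannZeta hs).differentiableWithinAt
  have hmem : (σ : ℂ) ∈ ({1}ᶜ : Set ℂ) := by simpa using hσ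
  have htend : Tendsto (fun t : ℝ => (σ : ℂ) + Complex.I * t) (𝓝[≠] 0) (𝓝[≠] (σ : ℂ)) := by
    refine tendsto_nhdsWithin_iff.2 ⟨?_, ?_⟩
    · have : Continuous fun t : ℝ => (σ : ℂ) + Complex.I * t := by fun_prop
      simpa using (this.tendsto 0).mono_left nhdsWithin_le_nhds
    · filter_upwards [self_mem_nhdsWithin] with t ht
      simpa using ht
  have hfreq : ∃ᶠ z in 𝓝[≠] (σ : ℂ), riemannZeta z = L :=
    htend.frequently (Eventually.of_forall h).frequently
  have heq := (hd.analyticOnNhd isOpen_compl_singleton).eqOn_of_preconnected_of_frequently_eq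
    (analyticOnNhd_const (v := L)) hU hmem hfreq
  -- The identity theorem makes zeta constant, contradicting `ζ(0) = -1/2` and `ζ(-2) = 0`.
  have h0 : riemannZeta 0 = L := heq (by simp)
  have h2 : riemannZeta (-2 * ((0 : ℕ) + 1)) = L := heq (by norm_num)
  rw [riemannZeta_neg_two_mul_nat_add_one] at h2
  rw [riemannZeta_zero, ← h2] at h0
  norm_num at h0

theorem continuous_riemannZeta_verticalLine {σ : ℝ} (hσ : σ ≠ 1) :
    Continuous fun t : ℝ => riemannZeta (σ + Complex.I * t) := by
  rw [continuous_iff_continuousAt]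
  intro t
  have hne : (σ : ℂ) + Complex.I * t ≠ 1 := fun h => hσ (by simpa using congrArg Complex.re h)
  exact ContinuousAt.comp (f := fun t : ℝ => (σ : ℂ) + Complex.I * t)
    (differentiableAt_riemannZeta hne).continuousAt (by fun_prop)

theorem re_cesaroMean_ofReal (w : ℕ → ℝ) (N : ℕ) :
    (cesaroMean (fun n => (w n : ℂ)) N).re = (∑ n ∈ Finset.range N, w n) / N := by
  have : cesaroMean (fun n => (w n : ℂ)) N = (((∑ n ∈ Finset.range N, w n) / N : ℝ) : ℂ) := by
    rw [cesaroMean]; push_cast; ring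
  rw [this, Complex.ofReal_re]

/-- A nonempty open set of the line supports a continuous weight on the circle of positive mean. -/
theorem exists_weight_of_isOpen {α : ℝ} (hα : α ≠ 0) (β : ℝ) {U : Set ℝ} (hU : IsOpen U)
    (hne : U.Nonempty) :
    ∃ g : C(AddCircle Real.pi, ℝ), (∀ t, 0 ≤ g t) ∧ (∀ x, g (booleCircle α β x) ≠ 0 → x ∈ U) ∧
      0 < ∫ t, g t ∂AddCircle.haarAddCircle := by
  set V := booleCircle α β '' U
  have hV : IsOpen V := isOpenMap_booleCircle hα β U hU
  -- The point 0, the image of infinity, is missed; `Metric.infDist` to an empty set would be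
  -- identically 0.
  have hVc : (Vᶜ).Nonempty := by
    refine ⟨0, ?_⟩
    rintro ⟨x, -, hx⟩
    have hm := booleAngle_mem_Ioo α β x
    refine hm.1.ne' ((AddCircle.coe_eq_coe_iff_of_mem_Ico (p := Real.pi) (a := 0) ?_ ?_).1 hx)
    · rw [zero_add]; exact Set.Ioo_subset_Ico_self hm
    · rw [zero_add]; exact ⟨le_rfl, Real.pi_pos⟩
  refine ⟨⟨fun t => Metric.infDist t Vᶜ, Metric.continuous_infDist_pt _⟩,
    fun t => Metric.infDist_nonneg, fun x hx => ?_, ?_⟩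
  · by_contra hxU
    refine hx (Metric.infDist_zero_of_mem ?_)
    rintro ⟨y, hy, hyx⟩
    exact hxU (booleCircle_injective hα β hyx ▸ hy)
  · obtain ⟨x, hx⟩ := hne
    refine (Metric.continuous_infDist_pt _).integral_pos_of_hasCompactSupport_nonneg_nonzero
      (HasCompactSupport.of_compactSpace _) (fun t => Metric.infDist_nonneg)
      (x := booleCircle α β x) ?_
    refine ((hV.isClosed_compl.notMem_iff_infDist_pos hVc).1 ?_).ne'
    exact fun h => h ⟨x, hx, rfl⟩

end

theorem theorem1p5 (α β : ℝ) (hα : 0 < α) (p : ℝ≥0∞) (hp : 1 ≤ p) (κ : ℕ → ℕ)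
    (hHartman : IsHartmanUniformlyDistributed κ) (hgood : IsLpGoodUniversal p κ)
    (σ : ℝ) (hσ : σ ∈ Set.Ioo (1 / 2 : ℝ) 1) :
    ∀ᵐ x : ℝ ∂volume,
      ∑' N : ℕ, ‖zetaAverage (booleMap α β) κ (σ : ℂ) x (N + 2)
        - zetaAverage (booleMap α β) κ (σ : ℂ) x (N + 1)‖ₑ = ∞ := by
  filter_upwards [ae_tendsto_cesaroMean_booleMap hα.ne' β hHartman.1 hgood] with x hx
  -- `L` may depend on `x`: equidistribution at `x` already covers every continuous weight.
  refine tsum_enorm_cesaroMean_sub_eq_top fun L => ?_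
  obtain ⟨c, hc⟩ := exists_riemannZeta_ne hσ.2.ne L
  have hpos : 0 < ‖riemannZeta (σ + Complex.I * c) - L‖ := norm_pos_iff.2 (sub_ne_zero.2 hc)
  obtain ⟨g, hg0, hgU, hgpos⟩ := exists_weight_of_isOpen hα.ne' β
    (U := {t : ℝ | ‖riemannZeta (σ + Complex.I * c) - L‖ / 2 <
      ‖riemannZeta (σ + Complex.I * t) - L‖})
    (isOpen_lt continuous_const
      ((continuous_riemannZeta_verticalLine hσ.2.ne).sub continuous_const).norm)
    ⟨c, half_lt_self hpos⟩
  refine ⟨fun n => g (booleCircle α β ((booleMap α β)^[κ n] x)), ‖g‖,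
    ‖riemannZeta (σ + Complex.I * c) - L‖ / 2, _, half_pos hpos, hgpos, fun n => hg0 _,
    fun n => (le_abs_self _).trans (g.norm_coe_le_norm _), fun n hn => (hgU _ hn).le, ?_⟩
  have h := (Complex.continuous_re.tendsto _).comp
    (hx ⟨fun t => (g t : ℂ), Complex.continuous_ofReal.comp g.continuous⟩)
  simp only [ContinuousMap.coe_mk, integral_complex_ofReal, Complex.ofReal_re] at h
  exact h.congr fun N => re_cesaroMean_ofReal _ N
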